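/- Write $\sigma_1(B)\ge\sigma_2(B)\ge\cdots$ for the singular values of a real matrix $B$, counted with multiplicity, with $\sigma_k(B)=0$ when $k$ exceeds the number of rows or of columns of $B$. For a real random variable $Y$ let $$\|Y\|_{\psi_2}=\sup_{p\ge 1}\frac{1}{\sqrt p}\,\bigl(\mathbb{E}|Y|^p\bigr)^{1/p}.$$ There is an absolute constant $C>0$, and for every $K\ge 0$ there is a constant $c>0$ depending only on $K$, such that the following holds. Let $X=M+E$ be an $n\times T$ matrix, where $M$ is deterministic with $\operatorname{rank}(M)=r<T$, and the entries $E_{i,j}$ of the noise matrix $E$ are independent, have mean zero and variance $1$, and satisfy $\|E_{i,j}\|_{\psi_2}=K$. Let $A$ be the submatrix of $X$ formed by a fixed set of $n_A$ rows, let $S$ be the submatrix of $M$ formed by the same rows, and let $r_S=\operatorname{rank}(S)$. For every $t\ge 0$, if $$n_A<\bigl(\sqrt n-CK^2\sqrt T-2t\bigr)^2,$$ then with probability at least $1-2e^{-ct^2}$, $$\sigma_{r+1}(X)-\sigma_{r_S+1}(A)\;\ge\;\sqrt n-\sqrt{n_A}-CK^2\sqrt T-2t .$$ In particular, since $r_S\le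 r$, the same holds with $\sigma_{r+1}(A)$ in place of $\sigma_{r_S+1}(A)$. -/

import Mathlib

open MeasureTheory ProbabilityTheory
open scoped NNReal ENNReal

/-- The sub-Gaussian norm `‖X‖_ψ₂ = sup_{p ≥ 1} p^(-1/2) (E |X|^p)^(1/p)` of a random variable,
with values in `[0, ∞]`; the supremum is over all real `p ≥ 1`. -/
noncomputable def subgaussianNorm {Ω : Type*} [MeasurableSpace Ω] (X : Ω → ℝ) (μ : Measure Ω) :
    ℝ≥0∞ :=
  ⨆ (p : ℝ) (_ : 1 ≤ p), eLpNorm X (ENNReal.ofReal p) μ / ENNReal.ofReal (Real.sqrt p)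

/-- The `k`-th singular value `σ_k(A)` of a real matrix, for `k = 1, 2, …`, in decreasing order and
with multiplicity (so that `σ_1(A)` is the spectral norm); as usual, `σ_k(A) = 0` once `k` exceeds
the number of rows or of columns. Mathlib's `LinearMap.singularValues` counts from `0`. -/
noncomputable def singVal {m T : ℕ} (A : Matrix (Fin m) (Fin T) ℝ) (k : ℕ) : ℝ :=
  (Matrix.toEuclideanLin A).singularValues (k - 1)

/-- The matrix `X = M + E` of observations at the outcome `ω`: deterministic signal plus noise. -/
def observed {Ω : Type*} {n T : ℕ} (M : Matrix (Fin n) (Fin T) ℝ) (E : Fin n → Fin T → Ω → ℝ)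
    (ω : Ω) : Matrix (Fin n) (Fin T) ℝ :=
  M + Matrix.of fun i j => E i j ω

/-- The submatrix of `X` formed by the rows listed by `e`. -/
def selectRows {n nA T : ℕ} (X : Matrix (Fin n) (Fin T) ℝ) (e : Fin nA ↪ Fin n) :
    Matrix (Fin nA) (Fin T) ℝ :=
  X.submatrix e id

/-! For a unit vector `v`, `Xv = Mv + Ev` with `Mv` in `W = range M`, so `‖Xv‖ ≥ ‖Ev‖ - ‖P_W Ev‖`.
Uniformly in `v`, `‖Ev‖` differs from `√n` by at most a multiple of `K²√T` plus a deviation of order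
`t`; since `dim W = r < T`, `‖P_W Ev‖` is itself of that order. Hence `‖Xv‖` is bounded below on the
whole unit sphere of `ℝ^T`, and so are all `T` singular values, among them `σ_{r+1}(X)`. On the
other side `A - S` is a noise matrix with `n_A` rows, and by Weyl's inequality `σ_{r_S+1}(A) ≤ ‖A -
S‖`, which is about `√n_A`. Subtracting gives the gap.

The uniform bounds (`measureReal_exists_norm_noiseMap_le`,
`measureReal_exists_norm_orthogonalProjectionOnto_noiseMap_le`) are union bounds over `1/2`-nets of
at most `5^T` points, whose entropy is paid for by the `K²√T` term. For fixed `v`, the coordinates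
of `Ev` are independent with second moment one and sub-Gaussian, because a sub-Gaussian MGF survives
unit linear combinations. This gives a Bernstein bound for `‖Ev‖² - n` and a Gaussian tail for `⟨w,
Ev⟩`. -/

/-! ### Scalar sub-Gaussian variables: moments, square-exponential moments and MGFs -/

/-- The linear term integrates to zero for a centred variable, leaving only the square-exponential
moment. -/
theorem Real.exp_le_add_exp_sq (x : ℝ) : Real.exp x ≤ x + Real.exp (x ^ 2) := by
  have h2 := Real.add_one_le_exp (x ^ 2)
  rcases le_or_gt |x| 1 with hx | hx
  · have := (abs_le.1 (Real.abs_exp_sub_one_sub_id_le hx)).2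
    linarith
  · rcases lt_abs.1 hx with h | h
    · have : Real.exp x ≤ Real.exp (x ^ 2) := Real.exp_le_exp.2 (by nlinarith)
      linarith
    · have : Real.exp x ≤ 1 := Real.exp_le_one_iff.2 (by linarith)
      nlinarith

theorem Real.exp_le_one_add_add_sq_mul_exp_abs (x : ℝ) :
    Real.exp x ≤ 1 + x + x ^ 2 * Real.exp |x| := by
  have h := Complex.norm_exp_sub_sum_le_norm_mul_exp (x : ℂ) 2
  simp only [Finset.sum_range_succ, Finset.sum_range_zero] at h
  norm_num at h
  have h2 := (le_abs_self _).trans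
    ((Complex.norm_real (Real.exp x - (1 + x))).ge.trans ((by push_cast; exact h)))
  linarith

/-- If the even moments of `X` grow at most like `(αk)^k`, then `X ^ 2` has an exponential moment. -/
theorem lintegral_exp_mul_sq_le_two {Ω : Type*} [MeasurableSpace Ω] {μ : Measure Ω} {X : Ω → ℝ}
    (hX : AEMeasurable X μ) {α b : ℝ} (hα : 0 ≤ α) (hb : 0 ≤ b) (hαb : b * α * Real.exp 1 ≤ 1 / 2)
    (hmom : ∀ k : ℕ, ∫⁻ ω, ENNReal.ofReal (X ω ^ (2 * k)) ∂μ ≤ ENNReal.ofReal ((α * k) ^ k)) :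
    ∫⁻ ω, ENNReal.ofReal (Real.exp (b * X ω ^ 2)) ∂μ ≤ 2 := by
  have hexp : ∀ ω, ENNReal.ofReal (Real.exp (b * X ω ^ 2)) =
      ∑' k : ℕ, ENNReal.ofReal (b ^ k / k.factorial) * ENNReal.ofReal (X ω ^ (2 * k)) := by
    intro ω
    rw [Real.exp_eq_exp_ℝ, NormedSpace.exp_eq_tsum_div, ENNReal.ofReal_tsum_of_nonneg]
    · refine tsum_congr fun k => ?_
      rw [← ENNReal.ofReal_mul (by positivity)]
      congr 1
      rw [mul_pow, pow_mul]; ring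
    · intro k; positivity
    · exact Real.summable_pow_div_factorial _
  simp_rw [hexp]
  rw [lintegral_tsum (fun k => by fun_prop)]
  calc ∑' k : ℕ, ∫⁻ ω, ENNReal.ofReal (b ^ k / k.factorial) * ENNReal.ofReal (X ω ^ (2 * k)) ∂μ
      ≤ ∑' k : ℕ, ENNReal.ofReal ((1 / 2) ^ k) := by
        refine ENNReal.tsum_le_tsum fun k => ?_
        rw [lintegral_const_mul'' _ (by fun_prop)]
        refine (mul_le_mul_right (hmom k) _).trans ?_
        rw [← ENNReal.ofReal_mul (by positivity)]
        refine ENNReal.ofReal_le_ofReal ?_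
        -- Stirling in its crudest form cancels the moment growth `k^k` against `k!`, so the series
        -- becomes geometric with ratio `bαe ≤ 1/2`.
        have hk : (k : ℝ) ^ k / k.factorial ≤ Real.exp k :=
          Real.pow_div_factorial_le_exp (k : ℝ) (by positivity) k
        calc b ^ k / k.factorial * (α * k) ^ k = (b * α) ^ k * ((k : ℝ) ^ k / k.factorial) := by
              rw [mul_pow, mul_pow]; ring
          _ ≤ (b * α) ^ k * Real.exp k := by gcongr
          _ = (b * α * Real.exp 1) ^ k := by
              rw [mul_pow _ (Real.exp 1), ← Real.exp_nat_mul, mul_one]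
          _ ≤ (1 / 2) ^ k := by gcongr
    _ = 2 := by
        rw [← ENNReal.ofReal_tsum_of_nonneg (fun k => by positivity)
          summable_geometric_two, tsum_geometric_two]
        simp

theorem integrable_exp_mul_sq {Ω : Type*} [MeasurableSpace Ω] {μ : Measure Ω} {X : Ω → ℝ}
    (hX : AEMeasurable X μ) {b : ℝ}
    (h : ∫⁻ ω, ENNReal.ofReal (Real.exp (b * X ω ^ 2)) ∂μ ≤ 2) :
    Integrable (fun ω => Real.exp (b * X ω ^ 2)) μ ∧ ∫ ω, Real.exp (b * X ω ^ 2) ∂μ ≤ 2 := by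
  have hm : AEStronglyMeasurable (fun ω => Real.exp (b * X ω ^ 2)) μ :=
    (by fun_prop : AEMeasurable (fun ω => Real.exp (b * X ω ^ 2)) μ).aestronglyMeasurable
  have hn : 0 ≤ᵐ[μ] fun ω => Real.exp (b * X ω ^ 2) := .of_forall fun ω => (Real.exp_pos _).le
  refine ⟨⟨hm, (hasFiniteIntegral_iff_ofReal hn).2 (h.trans_lt (by simp))⟩, ?_⟩
  rw [integral_eq_lintegral_of_nonneg_ae hn hm]
  exact (ENNReal.toReal_mono (by simp) h).trans (by simp)

theorem lintegral_pow_le_of_subgaussianNorm_le {Ω : Type*} [MeasurableSpace Ω] {μ : Measure Ω}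
    [IsProbabilityMeasure μ] {X : Ω → ℝ} {K : ℝ≥0} (h : subgaussianNorm X μ ≤ K) (k : ℕ) :
    ∫⁻ ω, ENNReal.ofReal (X ω ^ (2 * k)) ∂μ ≤ ENNReal.ofReal ((2 * (K : ℝ) ^ 2 * k) ^ k) := by
  rcases Nat.eq_zero_or_pos k with rfl | hk
  · simp
  have hk1 : (1 : ℝ) ≤ k := by exact_mod_cast hk
  have hp : (1 : ℝ) ≤ 2 * k := by linarith
  have h1 : eLpNorm X (ENNReal.ofReal (2 * k)) μ / ENNReal.ofReal (√(2 * k)) ≤ K :=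
    (le_iSup₂_of_le (2 * k : ℝ) hp le_rfl).trans h
  rw [ENNReal.div_le_iff (by simp; positivity) ENNReal.ofReal_ne_top] at h1
  have h2 := ENNReal.rpow_le_rpow h1 (show (0 : ℝ) ≤ 2 * k by linarith)
  rw [eLpNorm_eq_lintegral_rpow_enorm_toReal (by simp; positivity) ENNReal.ofReal_ne_top,
    ENNReal.toReal_ofReal (by linarith), ← ENNReal.rpow_mul, one_div,
    inv_mul_cancel₀ (by positivity), ENNReal.rpow_one] at h2
  have e1 : ∀ ω, ENNReal.ofReal (X ω ^ (2 * k)) = ‖X ω‖ₑ ^ (2 * k : ℝ) := by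
    intro ω
    rw [Real.enorm_eq_ofReal_abs, ENNReal.ofReal_rpow_of_nonneg (abs_nonneg _) (by positivity)]
    congr 1
    rw [show (2 * k : ℝ) = ((2 * k : ℕ) : ℝ) by push_cast; ring, Real.rpow_natCast,
      pow_mul, pow_mul, sq_abs]
  simp_rw [e1]
  refine h2.trans (le_of_eq ?_)
  rw [show (K : ℝ≥0∞) = ENNReal.ofReal K by simp, ← ENNReal.ofReal_mul (by positivity),
    ENNReal.ofReal_rpow_of_nonneg (by positivity) (by positivity)]
  congr 1
  rw [show (2 * k : ℝ) = ((2 * k : ℕ) : ℝ) by push_cast; ring, Real.rpow_natCast,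
      pow_mul, mul_pow, Real.sq_sqrt (by positivity)]
  push_cast; ring

/-- A centred variable with an exponential moment of its square is sub-Gaussian. -/
theorem hasSubgaussianMGF_of_integral_exp_mul_sq_le {Ω : Type*} [MeasurableSpace Ω] {μ : Measure Ω}
    [IsProbabilityMeasure μ] {X : Ω → ℝ} (hX : AEMeasurable X μ) {b : ℝ≥0} (hb : 0 < b)
    (hi : Integrable (fun ω => Real.exp (b * X ω ^ 2)) μ)
    (h : ∫ ω, Real.exp (b * X ω ^ 2) ∂μ ≤ 2) (hint : Integrable X μ) (h0 : ∫ ω, X ω ∂μ = 0) :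
    HasSubgaussianMGF X (2 / b) μ := by
  have hb' : (0 : ℝ) < b := hb
  have key : ∀ l ω, l * X ω ≤ l ^ 2 / (2 * b) + b * X ω ^ 2 / 2 := by
    intro l ω
    have : l ^ 2 / (2 * b) + b * X ω ^ 2 / 2 - l * X ω = (l - b * X ω) ^ 2 / (2 * b) := by
      field_simp; ring
    have : 0 ≤ (l - b * X ω) ^ 2 / (2 * b) := by positivity
    linarith
  -- Jensen's inequality for the concave powers `x ^ θ`, `0 ≤ θ ≤ 1`
  have jensen : ∀ θ : ℝ, 0 ≤ θ → θ ≤ 1 →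
      Integrable (fun ω => Real.exp (θ * (b * X ω ^ 2))) μ ∧
        ∫ ω, Real.exp (θ * (b * X ω ^ 2)) ∂μ ≤ Real.exp θ := by
    intro θ h0 h1
    -- The chord of the convex exponential between `0` and `bX²`; after integration it gives `1 + θ
    -- ≤ e^θ`.
    have hle : ∀ ω, Real.exp (θ * (b * X ω ^ 2)) ≤ 1 + θ * (Real.exp (b * X ω ^ 2) - 1) := by
      intro ω
      have := convexOn_exp.2 (Set.mem_univ 0) (Set.mem_univ (b * X ω ^ 2))
        (show 0 ≤ 1 - θ by linarith) h0 (by ring)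
      simp at this
      linarith
    have hi2 : Integrable (fun ω => 1 + θ * (Real.exp (b * X ω ^ 2) - 1)) μ := by fun_prop
    have hi3 : Integrable (fun ω => Real.exp (θ * (b * X ω ^ 2))) μ := by
      refine hi2.mono' (by fun_prop : AEMeasurable _ μ).aestronglyMeasurable (.of_forall fun ω => ?_)
      rw [Real.norm_eq_abs, abs_of_pos (Real.exp_pos _)]; exact hle ω
    refine ⟨hi3, (integral_mono hi3 hi2 hle).trans ?_⟩
    rw [integral_add (by fun_prop) (by fun_prop), integral_const_mul,
      integral_sub (by fun_prop) (by fun_prop)]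
    simp
    have := Real.add_one_le_exp θ
    nlinarith
  have hint_exp : ∀ l, Integrable (fun ω => Real.exp (l * X ω)) μ := by
    intro l
    obtain ⟨hh, -⟩ := jensen (1 / 2) (by norm_num) (by norm_num)
    refine (hh.const_mul (Real.exp (l ^ 2 / (2 * b)))).mono'
      (by fun_prop : AEMeasurable _ μ).aestronglyMeasurable (.of_forall fun ω => ?_)
    rw [Real.norm_eq_abs, abs_of_pos (Real.exp_pos _), ← Real.exp_add]
    refine Real.exp_le_exp.2 ((key l ω).trans (le_of_eq (by ring)))
  refine ⟨hint_exp, fun l => ?_⟩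
  have hexp : ((2 / b : ℝ≥0) : ℝ) * l ^ 2 / 2 = l ^ 2 / b := by push_cast; ring
  rw [hexp, mgf]
  -- For small `l`, centring removes the linear term and `θ = l²/b` is admissible in `jensen`. For
  -- large `l`, the Young inequality `key` suffices, since the extra factor `e^{1/2}` is below
  -- `e^{l²/(2b)}`.
  rcases le_or_gt (l ^ 2 / b) 1 with hl | hl
  · obtain ⟨h1, h2⟩ := jensen (l ^ 2 / b) (by positivity) hl
    have e : ∀ ω, l ^ 2 / b * (b * X ω ^ 2) = (l * X ω) ^ 2 := fun ω => by field_simp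
    simp_rw [e] at h1 h2
    calc ∫ ω, Real.exp (l * X ω) ∂μ ≤ ∫ ω, (l * X ω + Real.exp ((l * X ω) ^ 2)) ∂μ :=
          integral_mono (hint_exp l) ((hint.const_mul l).add h1) fun ω => Real.exp_le_add_exp_sq _
      _ = ∫ ω, Real.exp ((l * X ω) ^ 2) ∂μ := by
          rw [integral_add (hint.const_mul l) h1, integral_const_mul, h0]; ring
      _ ≤ _ := h2
  · obtain ⟨h1, h2⟩ := jensen (1 / 2) (by norm_num) (by norm_num)
    calc ∫ ω, Real.exp (l * X ω) ∂μ
        ≤ ∫ ω, Real.exp (l ^ 2 / (2 * b)) * Real.exp (1 / 2 * (b * X ω ^ 2)) ∂μ := by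
          refine integral_mono (hint_exp l) (h1.const_mul _) fun ω => ?_
          simp only [← Real.exp_add]
          exact Real.exp_le_exp.2 ((key l ω).trans (le_of_eq (by ring)))
      _ ≤ Real.exp (l ^ 2 / (2 * b)) * Real.exp (1 / 2) := by
          rw [integral_const_mul]; gcongr
      _ ≤ Real.exp (l ^ 2 / b) := by
          rw [← Real.exp_add]
          refine Real.exp_le_exp.2 ?_
          have : l ^ 2 / (2 * b) = l ^ 2 / b / 2 := by field_simp
          linarith

/-- One term of the exponential series bounds `(lX)^{2k}` by `(2k)!(e^{lX} + e^{-lX})`. This leads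
from MGFs, which behave well under sums, back to moments and thus to exponential moments of squares.
-/
theorem ProbabilityTheory.HasSubgaussianMGF.lintegral_pow_le {Ω : Type*} [MeasurableSpace Ω]
    {μ : Measure Ω} [IsProbabilityMeasure μ] {X : Ω → ℝ} {c : ℝ≥0} (hc : 0 < c)
    (h : HasSubgaussianMGF X c μ) (k : ℕ) :
    ∫⁻ ω, ENNReal.ofReal (X ω ^ (2 * k)) ∂μ ≤
      ENNReal.ofReal ((2 * Real.exp 1 * c * k) ^ k) := by
  rcases Nat.eq_zero_or_pos k with rfl | hk
  · simp
  have hc' : (0 : ℝ) < c := hc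
  have hk' : (0 : ℝ) < k := by exact_mod_cast hk
  -- The choice optimizing the bound: it makes the MGF exponent `c l² / 2` equal to `k`.
  set l : ℝ := √(2 * k / c) with hl
  have hl2 : l ^ 2 = 2 * k / c := Real.sq_sqrt (by positivity)
  have hbd : ∀ ω, X ω ^ (2 * k) ≤ (2 * k).factorial / (l ^ 2) ^ k *
      (Real.exp (l * X ω) + Real.exp (-l * X ω)) := by
    intro ω
    have h1 := Real.pow_div_factorial_le_exp |l * X ω| (abs_nonneg _) (2 * k)
    have h2 : Real.exp |l * X ω| ≤ Real.exp (l * X ω) + Real.exp (-l * X ω) := by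
      have := Real.exp_pos (l * X ω)
      have := Real.exp_pos (-l * X ω)
      rcases abs_choice (l * X ω) with h | h <;> rw [h]
      · linarith
      · rw [← neg_mul]; linarith
    have h3 : |l * X ω| ^ (2 * k) = (l ^ 2) ^ k * X ω ^ (2 * k) := by
      rw [pow_mul, sq_abs, mul_pow, mul_pow, ← pow_mul (X ω)]
    have h4 := h1.trans h2
    rw [h3, div_le_iff₀ (by positivity)] at h4
    rw [div_mul_eq_mul_div, le_div_iff₀ (by rw [hl2]; positivity)]
    linarith
  have hint : Integrable (fun ω => (2 * k).factorial / (l ^ 2) ^ k *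
      (Real.exp (l * X ω) + Real.exp (-l * X ω))) μ :=
    ((h.integrable_exp_mul l).add (h.integrable_exp_mul (-l))).const_mul _
  refine (lintegral_mono fun ω => ENNReal.ofReal_le_ofReal (hbd ω)).trans ?_
  rw [← ofReal_integral_eq_lintegral_ofReal hint (.of_forall fun ω => by positivity)]
  refine ENNReal.ofReal_le_ofReal ?_
  rw [integral_const_mul, integral_add (h.integrable_exp_mul l) (h.integrable_exp_mul (-l))]
  have m1 := h.mgf_le l
  have m2 := h.mgf_le (-l)
  have e1 : c * l ^ 2 / 2 = k := by rw [hl2]; field_simp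
  rw [neg_sq, e1] at m2
  rw [e1] at m1
  rw [mgf] at m1 m2
  have hf : ((2 * k).factorial : ℝ) * 2 ≤ (2 * k) ^ (2 * k) := by
    have h2 := Nat.factorial_two_mul_le k
    have h3 := Nat.factorial_le_pow k
    have h4 : 2 ≤ 2 ^ k := Nat.le_self_pow hk.ne' 2
    have : (2 * k).factorial * 2 ≤ (2 * k) ^ (2 * k) := calc
      (2 * k).factorial * 2 ≤ (2 * k) ^ k * k ^ k * 2 ^ k := by gcongr; exact h2.trans (by gcongr)
      _ = (2 * k) ^ (2 * k) := by rw [two_mul k, pow_add (k + k), ← two_mul, mul_pow]; ring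
    exact_mod_cast this
  calc _ ≤ ((2 * k).factorial : ℝ) / (l ^ 2) ^ k * (Real.exp k + Real.exp k) := by gcongr
    _ = ((2 * k).factorial * 2) * Real.exp k / (2 * k / c) ^ k := by rw [hl2]; ring
    _ ≤ (2 * k) ^ (2 * k) * Real.exp k / (2 * k / c) ^ k := by gcongr
    _ = (2 * Real.exp 1 * c * k) ^ k := by
        rw [show Real.exp k = Real.exp 1 ^ k by rw [← Real.exp_nat_mul, mul_one], div_pow, pow_mul,
          ← mul_pow, div_div_eq_mul_div, ← mul_pow, ← div_pow]
        congr 1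
        field_simp

/-- The blocks of an independent family are independent. -/
theorem ProbabilityTheory.iIndepFun.curry {Ω ι κ β : Type*} [MeasurableSpace Ω] [MeasurableSpace β]
    {μ : Measure Ω} {X : ι → κ → Ω → β} (mX : ∀ i j, Measurable (X i j))
    (h : iIndepFun (fun p : ι × κ => X p.1 p.2) μ) :
    iIndepFun (fun i ω j => X i j ω) μ := by
  have := h.isProbabilityMeasure
  have hp : ∀ i j, IsProbabilityMeasure (μ.map (X i j)) :=
    fun i j => Measure.isProbabilityMeasure_map (mX i j).aemeasurable
  have hrow : ∀ i, iIndepFun (X i) μ := fun i =>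
    h.precomp (g := Prod.mk i) (Prod.mk_right_injective i)
  -- Reindexed by a sigma type, the joint law is a product measure that `piCurry` carries to an
  -- iterated product.
  have h' : iIndepFun (fun p : (_ : ι) × κ => X p.1 p.2) μ :=
    h.precomp (Equiv.sigmaEquivProd ι κ).injective
  have e : (MeasurableEquiv.piCurry fun (_ : ι) (_ : κ) => β) ∘ (fun ω p => X p.1 p.2 ω) =
      fun ω i j => X i j ω := by
    ext; simp [Sigma.curry]
  rw [iIndepFun_iff_map_fun_eq_infinitePi_map (by fun_prop)] at h' ⊢
  rw [← e, ← Measure.map_map (by fun_prop) (by fun_prop), h',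
    Measure.infinitePi_map_piCurry (fun i j => μ.map (X i j))]
  congr 1
  ext1 i
  rw [← (iIndepFun_iff_map_fun_eq_infinitePi_map (by fun_prop)).1 (hrow i)]

/-! ### Bernstein inequality for sums of squares -/

section MGF

variable {Ω : Type*} [MeasurableSpace Ω] {μ : Measure Ω} [IsProbabilityMeasure μ]

/-- Unit second moment and `1 + x ≤ e^x` give `b + 1 ≤ 2`. -/
theorem le_one_of_integral_exp_mul_sq_le {Y : Ω → ℝ} {b : ℝ}
    (hi : Integrable (fun ω => Real.exp (b * Y ω ^ 2)) μ)
    (h : ∫ ω, Real.exp (b * Y ω ^ 2) ∂μ ≤ 2)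
    (hY2 : Integrable (fun ω => Y ω ^ 2) μ) (hY : ∫ ω, Y ω ^ 2 ∂μ = 1) : b ≤ 1 := by
  have h1 : ∫ ω, (b * Y ω ^ 2 + 1) ∂μ ≤ ∫ ω, Real.exp (b * Y ω ^ 2) ∂μ :=
    integral_mono (by fun_prop) hi fun ω => Real.add_one_le_exp _
  rw [integral_add (by fun_prop) (by fun_prop), integral_const_mul, hY] at h1
  simp at h1
  linarith

/-- The moment generating function of `Y ^ 2 - 1` near the origin. -/
theorem mgf_sq_sub_one_le {Y : Ω → ℝ} (hm : AEMeasurable Y μ) {b : ℝ} (hb : 0 < b)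
    (hi : Integrable (fun ω => Real.exp (b * Y ω ^ 2)) μ)
    (h : ∫ ω, Real.exp (b * Y ω ^ 2) ∂μ ≤ 2)
    (hY2 : Integrable (fun ω => Y ω ^ 2) μ) (hY : ∫ ω, Y ω ^ 2 ∂μ = 1)
    {l : ℝ} (hl : |l| ≤ b / 2) :
    Integrable (fun ω => Real.exp (l * (Y ω ^ 2 - 1))) μ ∧
      mgf (fun ω => Y ω ^ 2 - 1) μ l ≤ Real.exp (48 * l ^ 2 / b ^ 2) := by
  have hb1 := le_one_of_integral_exp_mul_sq_le hi h hY2 hY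
  have hZ : ∀ ω, |Y ω ^ 2 - 1| ≤ Y ω ^ 2 + 1 := fun ω =>
    abs_le.2 ⟨by nlinarith [sq_nonneg (Y ω)], by linarith⟩
  have hlZ : ∀ ω, |l * (Y ω ^ 2 - 1)| ≤ b / 2 * |Y ω ^ 2 - 1| := fun ω => by
    rw [abs_mul]; gcongr
  -- Half of the available exponent, `e^{bz/2}`, absorbs the factor `z²`; the other half absorbs
  -- `e^{|l|z}`.
  have hbd : ∀ ω, (l * (Y ω ^ 2 - 1)) ^ 2 * Real.exp |l * (Y ω ^ 2 - 1)| ≤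
      8 * l ^ 2 / b ^ 2 * Real.exp b * Real.exp (b * Y ω ^ 2) := by
    intro ω
    set z := |Y ω ^ 2 - 1| with hz
    have hz0 : 0 ≤ z := abs_nonneg _
    have h1 : (b / 2 * z) ^ 2 / 2 ≤ Real.exp (b / 2 * z) := by
      have := Real.quadratic_le_exp_of_nonneg (show 0 ≤ b / 2 * z by positivity)
      have : 0 ≤ b / 2 * z := by positivity
      linarith
    have h2 : Real.exp |l * (Y ω ^ 2 - 1)| ≤ Real.exp (b / 2 * z) := Real.exp_le_exp.2 (hlZ ω)
    have h3 : Real.exp (b / 2 * z) * Real.exp (b / 2 * z) ≤ Real.exp b * Real.exp (b * Y ω ^ 2) := by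
      rw [← Real.exp_add, ← Real.exp_add]
      refine Real.exp_le_exp.2 ?_
      nlinarith [hZ ω]
    calc (l * (Y ω ^ 2 - 1)) ^ 2 * Real.exp |l * (Y ω ^ 2 - 1)|
        = 8 * l ^ 2 / b ^ 2 * ((b / 2 * z) ^ 2 / 2) * Real.exp |l * (Y ω ^ 2 - 1)| := by
          rw [mul_pow, mul_pow, hz, sq_abs]; field_simp; ring
      _ ≤ 8 * l ^ 2 / b ^ 2 * Real.exp (b / 2 * z) * Real.exp (b / 2 * z) := by gcongr
      _ = 8 * l ^ 2 / b ^ 2 * (Real.exp (b / 2 * z) * Real.exp (b / 2 * z)) := by ring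
      _ ≤ 8 * l ^ 2 / b ^ 2 * (Real.exp b * Real.exp (b * Y ω ^ 2)) := by gcongr
      _ = _ := by ring
  have hle : ∀ ω, Real.exp (l * (Y ω ^ 2 - 1)) ≤ 1 + l * (Y ω ^ 2 - 1) +
      8 * l ^ 2 / b ^ 2 * Real.exp b * Real.exp (b * Y ω ^ 2) := fun ω =>
    (Real.exp_le_one_add_add_sq_mul_exp_abs _).trans (by linarith [hbd ω])
  have hi2 : Integrable (fun ω => 1 + l * (Y ω ^ 2 - 1) +
      8 * l ^ 2 / b ^ 2 * Real.exp b * Real.exp (b * Y ω ^ 2)) μ := by fun_prop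
  have hi3 : Integrable (fun ω => Real.exp (l * (Y ω ^ 2 - 1))) μ := by
    refine hi2.mono' (by fun_prop : AEMeasurable _ μ).aestronglyMeasurable (.of_forall fun ω => ?_)
    rw [Real.norm_eq_abs, abs_of_pos (Real.exp_pos _)]; exact hle ω
  refine ⟨hi3, (integral_mono hi3 hi2 hle).trans ?_⟩
  rw [integral_add (by fun_prop) (by fun_prop), integral_add (by fun_prop) (by fun_prop),
    integral_const_mul, integral_const_mul, integral_sub (by fun_prop) (by fun_prop), hY]
  -- With `b ≤ 1`, the constant is `48 = 8 · 3 · 2`.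
  have he : Real.exp b ≤ 3 :=
    (Real.exp_le_exp.2 hb1).trans (by linarith [Real.exp_one_lt_d9])
  have h4 : 8 * l ^ 2 / b ^ 2 * Real.exp b * ∫ ω, Real.exp (b * Y ω ^ 2) ∂μ ≤
      8 * l ^ 2 / b ^ 2 * 3 * 2 := by gcongr
  have h5 := Real.add_one_le_exp (48 * l ^ 2 / b ^ 2)
  have h6 : 8 * l ^ 2 / b ^ 2 * 3 * 2 = 48 * l ^ 2 / b ^ 2 := by ring
  simp
  linarith

/-- Bernstein-type bound for the squared length of a vector with independent coordinates. -/
theorem measureReal_abs_sum_sq_sub_ge_le {m : ℕ} {Y : Fin m → Ω → ℝ}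
    (hind : iIndepFun Y μ) (hm : ∀ i, Measurable (Y i)) {b : ℝ} (hb : 0 < b)
    (hi : ∀ i, Integrable (fun ω => Real.exp (b * Y i ω ^ 2)) μ)
    (h : ∀ i, ∫ ω, Real.exp (b * Y i ω ^ 2) ∂μ ≤ 2)
    (hY2 : ∀ i, Integrable (fun ω => Y i ω ^ 2) μ) (hY : ∀ i, ∫ ω, Y i ω ^ 2 ∂μ = 1)
    {s : ℝ} (hs : 0 ≤ s) :
    μ.real {ω | max (s * √m) (s ^ 2) / 32 ≤ |∑ i, Y i ω ^ 2 - m|} ≤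
      2 * Real.exp (-(b ^ 2 * s ^ 2 / 196608)) := by
  -- Without coordinates `b ≤ 1` is unavailable; the event is then empty unless `s = 0`, where the
  -- bound exceeds one.
  rcases Nat.eq_zero_or_pos m with rfl | hm0
  · rcases hs.eq_or_lt with rfl | hs0
    · refine measureReal_le_one.trans ?_
      simp
    · have he : {ω | max (s * √((0 : ℕ) : ℝ)) (s ^ 2) / 32 ≤
          |∑ i : Fin 0, Y i ω ^ 2 - ((0 : ℕ) : ℝ)|} = ∅ := by
        ext ω
        have : 0 < max (s * √((0 : ℕ) : ℝ)) (s ^ 2) / 32 :=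
          div_pos (lt_max_of_lt_right (by positivity)) (by norm_num)
        simpa using this
      rw [he]
      simp
      positivity
  have hb1 : b ≤ 1 :=
    le_one_of_integral_exp_mul_sq_le (hi ⟨0, hm0⟩) (h ⟨0, hm0⟩) (hY2 ⟨0, hm0⟩) (hY ⟨0, hm0⟩)
  have hmgf : ∀ l : ℝ, |l| ≤ b / 2 →
      Integrable (fun ω => Real.exp (l * (∑ i, Y i ω ^ 2 - m))) μ ∧
      mgf (fun ω => ∑ i, Y i ω ^ 2 - m) μ l ≤ Real.exp (48 * m * l ^ 2 / b ^ 2) := by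
    intro l hl
    have hind' : iIndepFun (fun i ω => Y i ω ^ 2 - 1) μ :=
      hind.comp (fun _ x => x ^ 2 - 1) fun _ => by fun_prop
    have e : (fun ω => ∑ i, Y i ω ^ 2 - m) = ∑ i, fun ω => Y i ω ^ 2 - 1 := by
      ext ω; simp
    have hint := fun i => (mgf_sq_sub_one_le (hm i).aemeasurable hb (hi i) (h i) (hY2 i) (hY i) hl)
    constructor
    · have := hind'.integrable_exp_mul_sum (t := l) (s := Finset.univ) (by fun_prop)
        fun i _ => (hint i).1
      rw [← e] at this
      exact this
    · rw [e, hind'.mgf_sum (by fun_prop)]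
      calc ∏ i, mgf (fun ω => Y i ω ^ 2 - 1) μ l ≤ ∏ _i : Fin m, Real.exp (48 * l ^ 2 / b ^ 2) :=
            Finset.prod_le_prod (fun i _ => mgf_nonneg) fun i _ => (hint i).2
        _ = _ := by simp [← Real.exp_nat_mul]; ring
  set D := max (s * √m) (s ^ 2) / 32 with hD
  -- the optimal value of the parameter in the exponential Markov inequality
  obtain ⟨l, hl0, hlb, hl⟩ : ∃ l : ℝ, 0 ≤ l ∧ l ≤ b / 2 ∧
      -l * D + 48 * m * l ^ 2 / b ^ 2 ≤ -(b ^ 2 * s ^ 2 / 196608) := by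
    have hb2 : b ^ 2 / 3072 ≤ b / 2 := by nlinarith
    have hm0 : (0 : ℝ) ≤ m := by positivity
    rcases le_or_gt s √m with hsm | hsm
    · rcases hs.eq_or_lt with rfl | hs0
      · exact ⟨0, le_rfl, by positivity, by simp⟩
      have hm1 : 0 < √(m : ℝ) := hs0.trans_le hsm
      -- The minimizer of the quadratic with `D` replaced by `s√m/32`: `3072 = 2 · 48 · 32`, with
      -- minimum `-b²s²/(4 · 48 · 32²)`. For `s > √m` the value at `s = √m` is kept.
      refine ⟨b ^ 2 / 3072 * (s / √m), by positivity, ?_, ?_⟩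
      · refine le_trans (mul_le_of_le_one_right (by positivity) ?_) hb2
        exact (div_le_one hm1).2 hsm
      · have h1 : s * √m / 32 ≤ D := by rw [hD]; gcongr; exact le_max_left _ _
        have h2 : b ^ 2 / 3072 * (s / √m) * (s * √m / 32) ≤ b ^ 2 / 3072 * (s / √m) * D := by
          gcongr
        have h3 : b ^ 2 / 3072 * (s / √m) * (s * √m / 32) = b ^ 2 * s ^ 2 / 98304 := by
          field_simp; norm_num
        have h4 : 48 * m * (b ^ 2 / 3072 * (s / √m)) ^ 2 / b ^ 2 = b ^ 2 * s ^ 2 / 196608 := by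
          rw [mul_pow, div_pow s, Real.sq_sqrt hm0]
          have : (m : ℝ) ≠ 0 := by rintro h; simp [h] at hm1
          field_simp; norm_num
        rw [h4]; linarith
    · refine ⟨b ^ 2 / 3072, by positivity, hb2, ?_⟩
      have h1 : s ^ 2 / 32 ≤ D := by rw [hD]; gcongr; exact le_max_right _ _
      have h2 : b ^ 2 / 3072 * (s ^ 2 / 32) ≤ b ^ 2 / 3072 * D := by gcongr
      have h5 : (m : ℝ) ≤ s ^ 2 := by
        rw [← Real.sq_sqrt hm0]; gcongr
      have h4 : 48 * m * (b ^ 2 / 3072) ^ 2 / b ^ 2 ≤ 48 * s ^ 2 * (b ^ 2 / 3072) ^ 2 / b ^ 2 := by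
        gcongr
      have h6 : 48 * s ^ 2 * (b ^ 2 / 3072) ^ 2 / b ^ 2 = b ^ 2 * s ^ 2 / 196608 := by
        field_simp; ring
      linarith
  have up := measure_ge_le_exp_mul_mgf (X := fun ω => ∑ i, Y i ω ^ 2 - m) D hl0
    (hmgf l (by rwa [abs_of_nonneg hl0])).1
  have lo := measure_le_le_exp_mul_mgf (X := fun ω => ∑ i, Y i ω ^ 2 - m) (t := -l) (-D)
    (by linarith) (hmgf (-l) (by rwa [abs_neg, abs_of_nonneg hl0])).1
  have up2 := (hmgf l (by rwa [abs_of_nonneg hl0])).2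
  have lo2 := (hmgf (-l) (by rwa [abs_neg, abs_of_nonneg hl0])).2
  have hsub : {ω | D ≤ |∑ i, Y i ω ^ 2 - m|} ⊆
      {ω | D ≤ ∑ i, Y i ω ^ 2 - m} ∪ {ω | ∑ i, Y i ω ^ 2 - m ≤ -D} := by
    intro ω hω
    rcases le_abs.1 (Set.mem_ofPred.1 hω) with h | h
    · exact Or.inl h
    · exact Or.inr (by simp only [Set.mem_ofPred_eq]; linarith)
  refine (measureReal_mono hsub).trans ((measureReal_union_le _ _).trans ?_)
  have fin : Real.exp (-l * D) * Real.exp (48 * m * l ^ 2 / b ^ 2) ≤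
      Real.exp (-(b ^ 2 * s ^ 2 / 196608)) := by
    rw [← Real.exp_add]; exact Real.exp_le_exp.2 hl
  have u3 := up.trans ((mul_le_mul_of_nonneg_left up2 (Real.exp_pos _).le).trans fin)
  rw [neg_sq] at lo2
  have l3 := lo.trans ((mul_le_mul_of_nonneg_left lo2 (Real.exp_pos _).le).trans
    (by simpa using fin))
  linarith

end MGF

/-! ### Noise matrices acting on a fixed vector -/

section Noise

/-- The random linear map defined by a random matrix. -/
noncomputable def noiseMap {Ω : Type*} {m T : ℕ} (E : Fin m → Fin T → Ω → ℝ) (ω : Ω) :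
    EuclideanSpace ℝ (Fin T) →L[ℝ] EuclideanSpace ℝ (Fin m) :=
  LinearMap.toContinuousLinearMap (Matrix.toEuclideanLin (Matrix.of fun i j => E i j ω))

theorem noiseMap_apply {Ω : Type*} {m T : ℕ} (E : Fin m → Fin T → Ω → ℝ) (ω : Ω)
    (v : EuclideanSpace ℝ (Fin T)) (i : Fin m) : noiseMap E ω v i = ∑ j, v j * E i j ω := by
  simp [noiseMap, Matrix.toLpLin_apply, Matrix.mulVec, dotProduct, mul_comm]

variable {Ω : Type*} [MeasurableSpace Ω] {μ : Measure Ω}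

/-- Matrices with independent standardized sub-Gaussian entries. -/
structure IsSubgaussianNoise {m T : ℕ} (E : Fin m → Fin T → Ω → ℝ) (K : ℝ≥0) (μ : Measure Ω) :
    Prop where
  measurable : ∀ i j, Measurable (E i j)
  indep : iIndepFun (fun p : Fin m × Fin T => E p.1 p.2) μ
  integral_eq_zero : ∀ i j, ∫ ω, E i j ω ∂μ = 0
  variance_eq_one : ∀ i j, variance (E i j) μ = 1
  subgaussianNorm_le : ∀ i j, subgaussianNorm (E i j) μ ≤ K

theorem ProbabilityTheory.HasSubgaussianMGF.sum_mul_of_iIndepFun {ι : Type*} [Fintype ι]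
    {X : ι → Ω → ℝ} (hind : iIndepFun X μ) {c : ℝ≥0} (h : ∀ i, HasSubgaussianMGF (X i) c μ)
    {a : ι → ℝ} (ha : ∑ i, a i ^ 2 = 1) :
    HasSubgaussianMGF (fun ω => ∑ i, a i * X i ω) c μ := by
  have h1 : iIndepFun (fun i ω => a i * X i ω) μ :=
    hind.comp (fun i x => a i * x) fun _ => by fun_prop
  have h2 := HasSubgaussianMGF.sum_of_iIndepFun h1 (s := Finset.univ)
    (c := fun i => Real.toNNReal (a i ^ 2) * c) fun i _ => by
      rw [Real.toNNReal_of_nonneg (sq_nonneg _)]; exact (h i).const_mul (a i)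
  rwa [← Finset.sum_mul, ← Real.toNNReal_sum_of_nonneg fun i _ => sq_nonneg _, ha,
    Real.toNNReal_one, one_mul] at h2

variable {m T : ℕ} {E : Fin m → Fin T → Ω → ℝ} {K : ℝ≥0}

namespace IsSubgaussianNoise

theorem comp_embedding {k : ℕ} (hE : IsSubgaussianNoise E K μ) (e : Fin k ↪ Fin m) :
    IsSubgaussianNoise (fun i => E (e i)) K μ where
  measurable i := hE.measurable (e i)
  indep := hE.indep.precomp (g := Prod.map e id) (e.injective.prodMap Function.injective_id)
  integral_eq_zero i := hE.integral_eq_zero (e i)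
  variance_eq_one i := hE.variance_eq_one (e i)
  subgaussianNorm_le i := hE.subgaussianNorm_le (e i)

theorem indep_noiseMap (hE : IsSubgaussianNoise E K μ) (v : EuclideanSpace ℝ (Fin T)) :
    iIndepFun (fun i ω => noiseMap E ω v i) μ := by
  simp_rw [noiseMap_apply]
  exact (hE.indep.curry hE.measurable).comp (fun _ x => ∑ j, v j * x j) fun _ => by fun_prop

theorem measurable_noiseMap (hE : IsSubgaussianNoise E K μ) (v : EuclideanSpace ℝ (Fin T))
    (i : Fin m) : Measurable fun ω => noiseMap E ω v i := by
  have := hE.measurable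
  simp_rw [noiseMap_apply]
  fun_prop

variable [IsProbabilityMeasure μ]

theorem integral_exp_le (hE : IsSubgaussianNoise E K μ) (hK : 0 < K) (i : Fin m) (j : Fin T) :
    Integrable (fun ω => Real.exp ((1 / (12 * K ^ 2) : ℝ≥0) * E i j ω ^ 2)) μ ∧
      ∫ ω, Real.exp ((1 / (12 * K ^ 2) : ℝ≥0) * E i j ω ^ 2) ∂μ ≤ 2 := by
  have hm := (hE.measurable i j).aemeasurable (μ := μ)
  refine integrable_exp_mul_sq hm (lintegral_exp_mul_sq_le_two hm (α := 2 * K ^ 2) (by positivity)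
    (by positivity) ?_ (lintegral_pow_le_of_subgaussianNorm_le (hE.subgaussianNorm_le i j)))
  have hK' : (0 : ℝ) < K := hK
  push_cast
  rw [show 1 / (12 * (K : ℝ) ^ 2) * (2 * K ^ 2) = 1 / 6 by field_simp; norm_num]
  linarith [Real.exp_one_lt_d9]

theorem memLp_two (hE : IsSubgaussianNoise E K μ) (i : Fin m) (j : Fin T) :
    MemLp (E i j) 2 μ := by
  refine memLp_two_of_variance_ne_zero (hE.measurable i j).aestronglyMeasurable ?_
  simp [hE.variance_eq_one]

theorem hasSubgaussianMGF (hE : IsSubgaussianNoise E K μ) (hK : 0 < K) (i : Fin m) (j : Fin T) :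
    HasSubgaussianMGF (E i j) (24 * K ^ 2) μ := by
  obtain ⟨h1, h2⟩ := hE.integral_exp_le hK i j
  have h := hasSubgaussianMGF_of_integral_exp_mul_sq_le (hE.measurable i j).aemeasurable
    (by positivity) h1 h2 ((hE.memLp_two i j).integrable (by norm_num)) (hE.integral_eq_zero i j)
  convert h using 1
  field_simp; norm_num

/-- Unit variance keeps `K` away from zero, which later allows `K` to be replaced by a multiple of
`K²`. -/
theorem one_le_mul_sq (hE : IsSubgaussianNoise E K μ) (hK : 0 < K) (i : Fin m) (j : Fin T) :
    1 ≤ 12 * (K : ℝ) ^ 2 := by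
  obtain ⟨h1, h2⟩ := hE.integral_exp_le hK i j
  have hL := hE.memLp_two i j
  have hv := variance_eq_sub hL
  rw [hE.variance_eq_one, hE.integral_eq_zero] at hv
  have := le_one_of_integral_exp_mul_sq_le h1 h2 hL.integrable_sq (by simpa using hv.symm)
  push_cast at this
  have hK' : (0 : ℝ) < K := hK
  rwa [div_le_one (by positivity)] at this

theorem hasSubgaussianMGF_noiseMap (hE : IsSubgaussianNoise E K μ) (hK : 0 < K)
    {v : EuclideanSpace ℝ (Fin T)} (hv : ‖v‖ = 1) (i : Fin m) :
    HasSubgaussianMGF (fun ω => noiseMap E ω v i) (24 * K ^ 2) μ := by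
  simp_rw [noiseMap_apply]
  refine HasSubgaussianMGF.sum_mul_of_iIndepFun
    (hE.indep.precomp (g := Prod.mk i) (Prod.mk_right_injective i))
    (fun j => hE.hasSubgaussianMGF hK i j) ?_
  rw [← EuclideanSpace.real_norm_sq_eq, hv, one_pow]

theorem integral_sq_noiseMap (hE : IsSubgaussianNoise E K μ)
    {v : EuclideanSpace ℝ (Fin T)} (hv : ‖v‖ = 1) (i : Fin m) :
    Integrable (fun ω => noiseMap E ω v i ^ 2) μ ∧ ∫ ω, noiseMap E ω v i ^ 2 ∂μ = 1 := by
  have hL : ∀ j, MemLp (fun ω => v j * E i j ω) 2 μ := fun j => (hE.memLp_two i j).const_mul _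
  have hL' : MemLp (fun ω => noiseMap E ω v i) 2 μ := by
    simp_rw [noiseMap_apply]
    exact memLp_finsetSum _ fun j _ => hL j
  refine ⟨hL'.integrable_sq, ?_⟩
  have hind : iIndepFun (fun j ω => v j * E i j ω) μ :=
    (hE.indep.precomp (g := Prod.mk i) (Prod.mk_right_injective i)).comp (fun j x => v j * x)
      fun _ => by fun_prop
  have h1 := IndepFun.variance_sum (s := Finset.univ) (fun j _ => hL j)
    fun j _ k _ hjk => hind.indepFun hjk
  have e : (∑ j, fun ω => v j * E i j ω) = fun ω => noiseMap E ω v i := by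
    ext ω; simp [noiseMap_apply]
  have hmean : ∫ ω, noiseMap E ω v i ∂μ = 0 := by
    simp_rw [noiseMap_apply]
    rw [integral_finsetSum _ fun j _ => (hL j).integrable (by norm_num)]
    simp [integral_const_mul, hE.integral_eq_zero]
  rw [e, variance_eq_sub hL', hmean] at h1
  simp only [variance_const_mul, hE.variance_eq_one, mul_one, ← EuclideanSpace.real_norm_sq_eq,
    hv] at h1
  simpa using h1

theorem measureReal_norm_sq_noiseMap_sub_ge_le (hE : IsSubgaussianNoise E K μ) (hK : 0 < K)
    {v : EuclideanSpace ℝ (Fin T)} (hv : ‖v‖ = 1) {s : ℝ} (hs : 0 ≤ s) :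
    μ.real {ω | max (s * √m) (s ^ 2) / 32 ≤ |‖noiseMap E ω v‖ ^ 2 - m|} ≤
      2 * Real.exp (-((1 / (900 * K ^ 2)) ^ 2 * s ^ 2 / 196608)) := by
  have hK' : (0 : ℝ) < K := hK
  simp_rw [EuclideanSpace.real_norm_sq_eq]
  have hexp : ∀ i, _ := fun i => integrable_exp_mul_sq (b := 1 / (900 * (K : ℝ) ^ 2))
    (hE.measurable_noiseMap v i).aemeasurable (μ := μ)
    (lintegral_exp_mul_sq_le_two (hE.measurable_noiseMap v i).aemeasurable
      (by positivity) (by positivity) ?_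
      ((hE.hasSubgaussianMGF_noiseMap hK hv i).lintegral_pow_le (by positivity)))
  · exact measureReal_abs_sum_sq_sub_ge_le (hE.indep_noiseMap v) (hE.measurable_noiseMap v)
      (by positivity) (fun i => (hexp i).1) (fun i => (hexp i).2)
      (fun i => (hE.integral_sq_noiseMap hv i).1) (fun i => (hE.integral_sq_noiseMap hv i).2) hs
  · push_cast
    -- The constant `900` is chosen so that this product, `4e²/75`, is below `1/2`.
    rw [show 1 / (900 * (K : ℝ) ^ 2) * (2 * Real.exp 1 * (24 * K ^ 2)) * Real.exp 1 =
      4 / 75 * Real.exp 1 ^ 2 by field_simp; norm_num]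
    nlinarith [Real.exp_one_lt_d9, Real.exp_pos 1]

theorem measureReal_inner_noiseMap_ge_le (hE : IsSubgaussianNoise E K μ) (hK : 0 < K)
    {v : EuclideanSpace ℝ (Fin T)} (hv : ‖v‖ = 1) {w : EuclideanSpace ℝ (Fin m)} (hw : ‖w‖ = 1)
    {u : ℝ} (hu : 0 ≤ u) :
    μ.real {ω | u ≤ inner ℝ w (noiseMap E ω v)} ≤ Real.exp (-(u ^ 2 / (48 * K ^ 2))) := by
  have h := HasSubgaussianMGF.sum_mul_of_iIndepFun (hE.indep_noiseMap v)
    (hE.hasSubgaussianMGF_noiseMap hK hv) (a := w)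
    (by rw [← EuclideanSpace.real_norm_sq_eq, hw, one_pow])
  have h2 := h.measure_ge_le hu
  have e : ∀ ω, inner ℝ w (noiseMap E ω v) = ∑ i, w i * noiseMap E ω v i := fun ω => by
    simp [PiLp.inner_apply, mul_comm]
  simp_rw [e]
  refine h2.trans (le_of_eq ?_)
  congr 1
  push_cast
  ring

end IsSubgaussianNoise

end Noise

/-! ### From nets to the whole sphere -/

section Deterministic

/-- The unit sphere has a `1/2`-net of at most `5 ^ d` points. -/
theorem exists_half_net_sphere (E : Type*) [NormedAddCommGroup E] [NormedSpace ℝ E]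
    [FiniteDimensional ℝ E] :
    ∃ N : Finset E, N.card ≤ 5 ^ Module.finrank ℝ E ∧ (∀ c ∈ N, ‖c‖ = 1) ∧
      ∀ x : E, ‖x‖ = 1 → ∃ c ∈ N, ‖x - c‖ ≤ 1 / 2 := by
  classical
  let P : Finset E → Prop := fun s =>
    (∀ c ∈ s, ‖c‖ = 1) ∧ ∀ c ∈ s, ∀ d ∈ s, c ≠ d → 1 / 2 ≤ ‖c - d‖
  have hcard : ∀ s, P s → s.card ≤ 5 ^ Module.finrank ℝ E := by
    intro s hs
    -- Doubling turns a `1/2`-separated set of unit vectors into a `1`-separated set in the ball of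
    -- radius `2`, as the packing bound requires. A separated set of maximal cardinality is then a
    -- net.
    have hinj : Function.Injective fun x : E => (2 : ℝ) • x :=
      smul_right_injective E two_ne_zero
    rw [← Finset.card_image_of_injective s hinj]
    refine Besicovitch.card_le_of_separated _ ?_ ?_
    · intro c hc
      obtain ⟨x, hx, rfl⟩ := Finset.mem_image.1 hc
      simp [norm_smul, hs.1 x hx]
    · intro c hc d hd hcd
      obtain ⟨x, hx, rfl⟩ := Finset.mem_image.1 hc
      obtain ⟨y, hy, rfl⟩ := Finset.mem_image.1 hd
      have := hs.2 x hx y hy fun h => hcd (by rw [h])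
      rw [← smul_sub, norm_smul]
      norm_num
      linarith
  let Q : ℕ → Prop := fun k => ∃ s, P s ∧ s.card = k
  have hQ0 : Q 0 := ⟨∅, by simp [P], rfl⟩
  obtain ⟨N, hN, hNc⟩ : Q (Nat.findGreatest Q (5 ^ Module.finrank ℝ E)) :=
    Nat.findGreatest_spec (Nat.zero_le _) hQ0
  refine ⟨N, hcard N hN, hN.1, fun x hx => ?_⟩
  by_contra! hfar
  have hxN : x ∉ N := fun h => by have := hfar x h; norm_num at this
  have hP : P (insert x N) := by
    refine ⟨?_, ?_⟩
    · intro c hc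
      rcases Finset.mem_insert.1 hc with rfl | hc
      exacts [hx, hN.1 c hc]
    · intro c hc d hd hcd
      rcases Finset.mem_insert.1 hc with hc' | hc' <;> rcases Finset.mem_insert.1 hd with hd' | hd'
      · exact absurd (hc'.trans hd'.symm) hcd
      · rw [hc']; exact (hfar d hd').le
      · rw [hd', norm_sub_rev]; exact (hfar c hc').le
      · exact hN.2 c hc' d hd' hcd
  have := Nat.le_findGreatest (P := Q) (hcard _ hP) ⟨_, hP, rfl⟩
  rw [Finset.card_insert_of_notMem hxN, ← hNc] at this
  omega

/-- A symmetric operator is controlled by its quadratic form on a `1/2`-net. -/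
theorem ContinuousLinearMap.norm_le_of_half_net {E : Type*} [NormedAddCommGroup E]
    [InnerProductSpace ℝ E] {B : E →L[ℝ] E} (hB : B.IsSymmetric) {N : Finset E}
    (hN1 : ∀ c ∈ N, ‖c‖ = 1) (hN : ∀ x : E, ‖x‖ = 1 → ∃ c ∈ N, ‖x - c‖ ≤ 1 / 2)
    {D : ℝ} (hD : 0 ≤ D) (h : ∀ c ∈ N, |inner ℝ (B c) c| ≤ D) : ‖B‖ ≤ 32 * D := by
  have key : ∀ x, ‖x‖ = 1 → |inner ℝ (B x) x| ≤ D + 31 / 32 * ‖B‖ := by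
    intro x hx
    obtain ⟨c, hc, hxc⟩ := hN x hx
    have e : inner ℝ (B x) x = inner ℝ (B c) c + inner ℝ (B (x + c)) (x - c) := by
      have hs := hB x c
      simp only [ContinuousLinearMap.coe_coe] at hs
      have hs2 := real_inner_comm (B c) x
      simp only [map_add, inner_add_left, inner_sub_right]
      linarith
    -- The parallelogram law improves on the triangle inequality, which would give a useless factor
    -- `1`: here `‖x + c‖‖x - c‖ ≤ √15/4 < 31/32`, so the error term can be absorbed into `‖B‖`.
    have h1 : ‖x + c‖ ^ 2 = 4 - ‖x - c‖ ^ 2 := by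
      have := parallelogram_law_with_norm ℝ x c
      rw [hx, hN1 c hc] at this
      nlinarith
    have h2 : ‖x + c‖ * ‖x - c‖ ≤ 31 / 32 := by
      refine abs_le_of_sq_le_sq' ?_ (by norm_num) |>.2
      rw [mul_pow, h1]
      have : ‖x - c‖ ^ 2 ≤ 1 / 4 := by
        nlinarith [norm_nonneg (x - c)]
      nlinarith
    have h3 : |inner ℝ (B (x + c)) (x - c)| ≤ 31 / 32 * ‖B‖ := by
      calc |inner ℝ (B (x + c)) (x - c)| ≤ ‖B (x + c)‖ * ‖x - c‖ := abs_real_inner_le_norm _ _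
        _ ≤ ‖B‖ * ‖x + c‖ * ‖x - c‖ := by gcongr; exact B.le_opNorm _
        _ = ‖B‖ * (‖x + c‖ * ‖x - c‖) := by ring
        _ ≤ ‖B‖ * (31 / 32) := by gcongr
        _ = _ := by ring
    rw [e]
    exact (abs_add_le _ _).trans (add_le_add (h c hc) h3)
  have : ‖B‖ ≤ D + 31 / 32 * ‖B‖ := by
    conv_lhs => rw [B.norm_eq_iSup_rayleighQuotient hB]
    refine ciSup_le fun x => ?_
    rcases eq_or_ne x 0 with rfl | hx
    · simp [ContinuousLinearMap.rayleighQuotient]; positivity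
    have hn : ‖x‖ ≠ 0 := norm_ne_zero_iff.2 hx
    have h1 := key (‖x‖⁻¹ • x) (by rw [norm_smul, norm_inv, norm_norm, inv_mul_cancel₀ hn])
    rw [map_smul, inner_smul_left, inner_smul_right] at h1
    have e : B.rayleighQuotient x = ‖x‖⁻¹ * (‖x‖⁻¹ * inner ℝ (B x) x) := by
      simp [ContinuousLinearMap.rayleighQuotient, ContinuousLinearMap.reApplyInnerSelf]
      field_simp
    rw [e]
    exact h1
  linarith

/-- If a linear map almost preserves the squared length (up to a factor) on a `1/2`-net, then it
does so on the whole sphere. -/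
theorem abs_norm_sub_sqrt_le_of_half_net {E F : Type*} [NormedAddCommGroup E]
    [InnerProductSpace ℝ E] [CompleteSpace E] [NormedAddCommGroup F] [InnerProductSpace ℝ F]
    [CompleteSpace F] (A : E →L[ℝ] F) {N : Finset E}
    (hN1 : ∀ c ∈ N, ‖c‖ = 1) (hN : ∀ x : E, ‖x‖ = 1 → ∃ c ∈ N, ‖x - c‖ ≤ 1 / 2)
    {a s : ℝ} (ha : 0 ≤ a) (hs : 0 ≤ s)
    (h : ∀ c ∈ N, |‖A c‖ ^ 2 - a| ≤ max (s * √a) (s ^ 2) / 32) {x : E} (hx : ‖x‖ = 1) :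
    |‖A x‖ - √a| ≤ s := by
  set B : E →L[ℝ] E := ContinuousLinearMap.adjoint A ∘L A - a • ContinuousLinearMap.id ℝ E with hBdef
  have hBi : ∀ x y, inner ℝ (B x) y = inner ℝ (A x) (A y) - a * inner ℝ x y := by
    intro x y
    simp [hBdef, inner_sub_left, ContinuousLinearMap.adjoint_inner_left, inner_smul_left]
  have hB : B.IsSymmetric := by
    intro x y
    simp only [ContinuousLinearMap.coe_coe]
    rw [hBi, real_inner_comm (B y) x, hBi, real_inner_comm (A x), real_inner_comm x]
  have hBq : ∀ x, ‖x‖ = 1 → inner ℝ (B x) x = ‖A x‖ ^ 2 - a := by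
    intro x hx
    rw [hBi, real_inner_self_eq_norm_sq, real_inner_self_eq_norm_sq, hx]; ring
  have hn := ContinuousLinearMap.norm_le_of_half_net hB hN1 hN
    (D := max (s * √a) (s ^ 2) / 32) (by positivity) fun c hc => by rw [hBq c (hN1 c hc)]; exact h c hc
  have h1 : |‖A x‖ ^ 2 - a| ≤ max (s * √a) (s ^ 2) := by
    rw [← hBq x hx]
    calc |inner ℝ (B x) x| ≤ ‖B x‖ * ‖x‖ := abs_real_inner_le_norm _ _
      _ ≤ ‖B‖ * ‖x‖ * ‖x‖ := by gcongr; exact B.le_opNorm _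
      _ = ‖B‖ := by rw [hx]; ring
      _ ≤ _ := by linarith
  by_contra! hlt
  have h2 : |‖A x‖ ^ 2 - a| = |‖A x‖ - √a| * (‖A x‖ + √a) := by
    rw [← abs_of_nonneg (show 0 ≤ ‖A x‖ + √a by positivity), ← abs_mul]
    congr 1
    nlinarith [Real.sq_sqrt ha]
  -- The factor `‖Ax‖ + √a` dominates both `√a` and `|‖Ax‖ - √a|`; these handle the two terms of the
  -- maximum.
  have h3 : |‖A x‖ - √a| ≤ ‖A x‖ + √a :=
    abs_le.2 ⟨by linarith [norm_nonneg (A x)], by linarith [Real.sqrt_nonneg a]⟩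
  have h4 : √a ≤ ‖A x‖ + √a := by linarith [norm_nonneg (A x)]
  rw [h2] at h1
  rcases le_max_iff.1 h1 with h5 | h5 <;> nlinarith [Real.sqrt_nonneg a]

/-- The projected image of the unit sphere is controlled by bilinear values on `1/2`-nets. -/
theorem norm_orthogonalProjectionOnto_le_of_half_net {E F : Type*} [NormedAddCommGroup E]
    [InnerProductSpace ℝ E] [NormedAddCommGroup F] [InnerProductSpace ℝ F]
    (A : E →L[ℝ] F) (W : Submodule ℝ F) [W.HasOrthogonalProjection] {N : Finset E} {N' : Finset W}
    (hN : ∀ x : E, ‖x‖ = 1 → ∃ c ∈ N, ‖x - c‖ ≤ 1 / 2)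
    (hN' : ∀ x : W, ‖x‖ = 1 → ∃ c ∈ N', ‖x - c‖ ≤ 1 / 2)
    {u : ℝ} (hu : 0 ≤ u) (h : ∀ c ∈ N, ∀ d ∈ N', inner ℝ (d : F) (A c) ≤ u) {x : E}
    (hx : ‖x‖ = 1) :
    ‖W.orthogonalProjectionOnto (A x)‖ ≤ 4 * u := by
  set G : E →L[ℝ] W := W.orthogonalProjectionOnto ∘L A
  have h1 : ∀ c ∈ N, ‖G c‖ ≤ 2 * u := by
    intro c hc
    rcases eq_or_ne (G c) 0 with h0 | h0
    · rw [h0, norm_zero]; positivity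
    have hn : ‖G c‖ ≠ 0 := norm_ne_zero_iff.2 h0
    set w : W := ‖G c‖⁻¹ • G c
    have hw : ‖w‖ = 1 := by rw [norm_smul, norm_inv, norm_norm, inv_mul_cancel₀ hn]
    obtain ⟨d, hd, hwd⟩ := hN' w hw
    have e1 : inner ℝ w (G c) = ‖G c‖ := by
      rw [inner_smul_left, real_inner_self_eq_norm_sq]; simp; field_simp
    have e2 : inner ℝ d (G c) ≤ u := by
      have := h c hc d hd
      rwa [← Submodule.inner_orthogonalProjectionOnto_eq_of_mem_left] at this
    have e3 : inner ℝ (w - d) (G c) ≤ 1 / 2 * ‖G c‖ :=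
      (real_inner_le_norm _ _).trans (by gcongr)
    rw [inner_sub_left] at e3
    linarith
  -- Each of the two nets costs a factor `2`.
  have h2 : ‖G‖ ≤ 2 * u + ‖G‖ * (1 / 2) := by
    refine G.opNorm_le_of_unit_norm (by positivity) fun y hy => ?_
    obtain ⟨c, hc, hyc⟩ := hN y hy
    calc ‖G y‖ = ‖G c + G (y - c)‖ := by rw [← map_add]; congr 2; abel
      _ ≤ ‖G c‖ + ‖G (y - c)‖ := norm_add_le _ _
      _ ≤ 2 * u + ‖G‖ * (1 / 2) := by
        gcongr
        · exact h1 c hc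
        · exact (G.le_opNorm _).trans (by gcongr)
  have h3 := G.le_opNorm x
  rw [hx] at h3
  change ‖G x‖ ≤ _
  linarith

end Deterministic

/-! ### Variational bounds for singular values -/

section SingularValues

open Module

variable {E F : Type*} [NormedAddCommGroup E] [InnerProductSpace ℝ E] [FiniteDimensional ℝ E]
  [NormedAddCommGroup F] [InnerProductSpace ℝ F] [FiniteDimensional ℝ F]

/-- A lower bound for `A` on the unit sphere bounds all its singular values from below. -/
theorem LinearMap.le_singularValues_of_forall_le_norm (A : E →ₗ[ℝ] F) {a : ℝ}
    (h : ∀ x, ‖x‖ = 1 → a ≤ ‖A x‖) {k : ℕ} (hk : k < finrank ℝ E) : a ≤ A.singularValues k := by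
  have hs := A.isSymmetric_adjoint_comp_self
  set v := hs.eigenvectorBasis rfl ⟨k, hk⟩
  have hv : ‖v‖ = 1 := (hs.eigenvectorBasis rfl).norm_eq_one _
  have e : ‖A v‖ ^ 2 = A.singularValues k ^ 2 := by
    rw [A.sq_singularValues_of_lt rfl hk, ← real_inner_self_eq_norm_sq,
      ← LinearMap.adjoint_inner_left, ← LinearMap.comp_apply, hs.apply_eigenvectorBasis rfl ⟨k, hk⟩]
    simp [inner_smul_left, hv, v]
  have e2 : ‖A v‖ = A.singularValues k :=
    (pow_left_inj₀ (norm_nonneg _) (A.singularValues_nonneg k) two_ne_zero).1 e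
  exact e2 ▸ h v hv

/-- A perturbation of norm at most `a` of a map of rank `r` has `(r + 1)`-st singular value at
most `a`. -/
theorem LinearMap.singularValues_finrank_range_le (A S : E →ₗ[ℝ] F) {a : ℝ} (ha : 0 ≤ a)
    (h : ∀ x, ‖x‖ = 1 → ‖A x - S x‖ ≤ a) : A.singularValues (finrank ℝ S.range) ≤ a := by
  -- Beyond the dimension of the domain the singular value is zero by convention.
  rcases le_or_gt (finrank ℝ E) (finrank ℝ S.range) with hk | hk
  · rwa [A.singularValues_of_finrank_le hk]
  have hs := A.isSymmetric_adjoint_comp_self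
  set b := hs.eigenvectorBasis rfl
  set r := finrank ℝ S.range
  let f : Fin (r + 1) → E := fun i => b (Fin.castLE hk i)
  have hf : Orthonormal ℝ f := b.orthonormal.comp _ (Fin.castLE_injective hk)
  -- a nonzero vector of the span of the leading singular vectors is annihilated by `S`
  obtain ⟨c, hc0, hc⟩ : ∃ c : EuclideanSpace ℝ (Fin (r + 1)), c ≠ 0 ∧
      S (∑ i, c i • f i) = 0 := by
    let G : EuclideanSpace ℝ (Fin (r + 1)) →ₗ[ℝ] S.range :=
      S.rangeRestrict ∘ₗ Fintype.linearCombination ℝ f ∘ₗ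
        (WithLp.linearEquiv 2 ℝ (Fin (r + 1) → ℝ)).toLinearMap
    have : G.ker ≠ ⊥ := LinearMap.ker_ne_bot_of_finrank_lt (by simp [r])
    obtain ⟨c, hc, hc0⟩ := Submodule.exists_mem_ne_zero_of_ne_bot this
    refine ⟨c, hc0, ?_⟩
    have := congrArg Subtype.val (LinearMap.mem_ker.1 hc)
    simpa [G, Fintype.linearCombination_apply] using this
  set x := ∑ i, c i • f i
  have hxn : ‖x‖ ^ 2 = ∑ i, c i ^ 2 := by
    rw [← real_inner_self_eq_norm_sq, hf.inner_sum]
    simp [sq]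
  have hx0 : ‖x‖ ≠ 0 := by
    intro h0
    rw [h0, ← EuclideanSpace.real_norm_sq_eq] at hxn
    simp at hxn
    exact hc0 (norm_eq_zero.1 (pow_eq_zero_iff two_ne_zero |>.1 hxn.symm))
  have hAx : A.singularValues r ^ 2 * ‖x‖ ^ 2 ≤ ‖A x‖ ^ 2 := by
    have e : (LinearMap.adjoint A ∘ₗ A) x =
        ∑ i, (c i * A.singularValues i ^ 2) • f i := by
      rw [map_sum]
      refine Finset.sum_congr rfl fun i _ => ?_
      rw [map_smul, hs.apply_eigenvectorBasis rfl, mul_smul]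
      congr 2
      exact (A.sq_singularValues_fin rfl (Fin.castLE hk i)).symm
    rw [← real_inner_self_eq_norm_sq (A x), ← LinearMap.adjoint_inner_left,
      ← LinearMap.comp_apply, e, hf.inner_sum, hxn, Finset.mul_sum]
    refine Finset.sum_le_sum fun i _ => ?_
    have h1 : A.singularValues r ≤ A.singularValues i :=
      A.singularValues_antitone (Nat.lt_succ_iff.1 i.2)
    have h2 : A.singularValues r ^ 2 ≤ A.singularValues i ^ 2 := by
      gcongr; exact A.singularValues_nonneg _
    simp
    nlinarith [mul_le_mul_of_nonneg_right h2 (sq_nonneg (c i))]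
  have h1 : A.singularValues r * ‖x‖ ≤ ‖A x‖ := by
    rw [← mul_pow] at hAx
    exact le_of_sq_le_sq hAx (norm_nonneg _)
  have h2 := h (‖x‖⁻¹ • x) (by rw [norm_smul, norm_inv, norm_norm, inv_mul_cancel₀ hx0])
  rw [map_smul, map_smul, hc, smul_zero, sub_zero, norm_smul, norm_inv, norm_norm] at h2
  have hx1 : 0 < ‖x‖ := (norm_nonneg x).lt_of_ne' hx0
  rw [inv_mul_le_iff₀ hx1] at h2
  nlinarith

/-- Adding a map with range in `W` cannot shrink a vector below its component orthogonal to `W`. -/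
theorem Submodule.norm_sub_norm_orthogonalProjectionOnto_le (W : Submodule ℝ F) {w : F} (hw : w ∈ W)
    (y : F) : ‖y‖ - ‖W.orthogonalProjectionOnto y‖ ≤ ‖w + y‖ := by
  have h1 : ‖y‖ ≤ ‖W.orthogonalProjectionOnto y‖ + ‖Wᗮ.orthogonalProjectionOnto y‖ := by
    conv_lhs => rw [← W.starProjection_add_starProjection_orthogonal y]
    exact norm_add_le _ _
  have h2 : Wᗮ.orthogonalProjectionOnto (w + y) = Wᗮ.orthogonalProjectionOnto y := by
    have : w ∈ Wᗮ.orthogonalProjectionOnto.ker := by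
      rw [Wᗮ.ker_orthogonalProjectionOnto]; exact W.le_orthogonal_orthogonal hw
    have h0 : Wᗮ.orthogonalProjectionOnto w = 0 := LinearMap.mem_ker.1 this
    rw [map_add, h0, zero_add]
  have h3 : ‖Wᗮ.orthogonalProjectionOnto (w + y)‖ ≤ ‖w + y‖ :=
    Wᗮ.norm_orthogonalProjectionOnto_apply_le _
  rw [h2] at h3
  linarith

end SingularValues

/-! ### Uniform bounds for the noise -/

section Concentration

theorem measureReal_biUnion_finset_le_of_card_le {Ω ι : Type*} [MeasurableSpace Ω] {μ : Measure Ω} {N : Finset ι} {k : ℕ}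
    (hN : N.card ≤ k) {A : ι → Set Ω} {p : ℝ} (hp : 0 ≤ p) (h : ∀ c ∈ N, μ.real (A c) ≤ p) :
    μ.real (⋃ c ∈ N, A c) ≤ k * p :=
  calc μ.real (⋃ c ∈ N, A c) ≤ ∑ c ∈ N, μ.real (A c) := measureReal_biUnion_finset_le _ _
    _ ≤ ∑ _c ∈ N, p := Finset.sum_le_sum h
    _ = N.card * p := by simp
    _ ≤ k * p := by gcongr

variable {Ω : Type*} [MeasurableSpace Ω] {μ : Measure Ω} [IsProbabilityMeasure μ]
  {m T : ℕ} {E : Fin m → Fin T → Ω → ℝ} {K : ℝ≥0}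

theorem five_pow_le_exp (T : ℕ) : (5 : ℝ) ^ T ≤ Real.exp (2 * T) := by
  have h : (5 : ℝ) ≤ Real.exp 2 := by
    have h1 := Real.exp_one_gt_d9
    rw [show (2 : ℝ) = 1 + 1 by norm_num, Real.exp_add]
    nlinarith
  calc (5 : ℝ) ^ T ≤ Real.exp 2 ^ T := by gcongr
    _ = Real.exp (2 * T) := by rw [← Real.exp_nat_mul, mul_comm]

namespace IsSubgaussianNoise

/-- If `K = 0`, the second moment would vanish, contradicting unit variance. -/
theorem pos (hE : IsSubgaussianNoise E K μ) (i : Fin m) (j : Fin T) : 0 < K := by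
  by_contra hK
  have hK0 : K = 0 := by simpa using hK
  have h1 := lintegral_pow_le_of_subgaussianNorm_le (hE.subgaussianNorm_le i j) 1
  have hL := hE.memLp_two i j
  have hv := variance_eq_sub hL
  rw [hE.variance_eq_one, hE.integral_eq_zero] at hv
  have hi : ∫ ω, E i j ω ^ (2 * 1) ∂μ = 1 := by simpa using hv.symm
  rw [← ofReal_integral_eq_lintegral_ofReal (by simpa using hL.integrable_sq)
    (.of_forall fun ω => (even_two_mul 1).pow_nonneg _), hi, hK0] at h1
  simp at h1

/-- All unit vectors are mapped to vectors of length close to `√m`. -/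
theorem measureReal_exists_norm_noiseMap_le (hE : IsSubgaussianNoise E K μ) (hK : 0 < K)
    {τ : ℝ} (hτ : 0 ≤ τ) :
    μ.real {ω | ∃ v, ‖v‖ = 1 ∧ 10 ^ 6 * (K : ℝ) ^ 2 * √T + τ < |‖noiseMap E ω v‖ - √m|} ≤
      2 * Real.exp (-((1 / (900 * K ^ 2)) ^ 2 * τ ^ 2 / 196608)) := by
  have hK' : (0 : ℝ) < K := hK
  set s := 10 ^ 6 * (K : ℝ) ^ 2 * √T + τ with hs
  have hs0 : 0 ≤ s := by positivity
  obtain ⟨N, hNc, hN1, hN⟩ := exists_half_net_sphere (EuclideanSpace ℝ (Fin T))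
  rw [finrank_euclideanSpace_fin] at hNc
  have hsub : {ω | ∃ v, ‖v‖ = 1 ∧ s < |‖noiseMap E ω v‖ - √m|} ⊆
      ⋃ c ∈ N, {ω | max (s * √m) (s ^ 2) / 32 ≤ |‖noiseMap E ω c‖ ^ 2 - m|} := by
    rintro ω ⟨v, hv, hlt⟩
    by_contra hω
    simp only [Set.mem_iUnion, not_exists, Set.mem_ofPred_eq, not_le] at hω
    exact hlt.not_ge (abs_norm_sub_sqrt_le_of_half_net (noiseMap E ω) hN1 hN (Nat.cast_nonneg m)
      hs0 (fun c hc => (hω c hc).le) hv)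
  refine (measureReal_mono hsub (measure_ne_top _ _)).trans ((measureReal_biUnion_finset_le_of_card_le hNc
    (by positivity) fun c hc =>
      hE.measureReal_norm_sq_noiseMap_sub_ge_le hK (hN1 c hc) hs0).trans ?_)
  have h1 : (10 ^ 6 * (K : ℝ) ^ 2 * √T) ^ 2 + τ ^ 2 ≤ s ^ 2 := by
    have : 0 ≤ 10 ^ 6 * (K : ℝ) ^ 2 * √T * τ := by positivity
    rw [hs, add_sq]; linarith
  rw [mul_pow, Real.sq_sqrt (Nat.cast_nonneg T)] at h1
  have h2 : (1 / (900 * (K : ℝ) ^ 2)) ^ 2 * ((10 ^ 6 * (K : ℝ) ^ 2) ^ 2 * T + τ ^ 2) / 196608 ≤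
      (1 / (900 * (K : ℝ) ^ 2)) ^ 2 * s ^ 2 / 196608 := by gcongr
  have h3 : (1 / (900 * (K : ℝ) ^ 2)) ^ 2 * ((10 ^ 6 * (K : ℝ) ^ 2) ^ 2 * T + τ ^ 2) / 196608 =
      10 ^ 12 / (810000 * 196608) * T + (1 / (900 * (K : ℝ) ^ 2)) ^ 2 * τ ^ 2 / 196608 := by
    field_simp
    ring
  -- The factor `10^6` makes this coefficient about `6`, enough to absorb the net cardinality `5^T ≤
  -- e^{2T}`.
  have h4 : (2 : ℝ) * T ≤ 10 ^ 12 / (810000 * 196608) * T := by gcongr; norm_num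
  calc ((5 ^ T : ℕ) : ℝ) * (2 * Real.exp (-((1 / (900 * (K : ℝ) ^ 2)) ^ 2 * s ^ 2 / 196608)))
      ≤ Real.exp (2 * T) * (2 * Real.exp (-((1 / (900 * (K : ℝ) ^ 2)) ^ 2 * s ^ 2 / 196608))) := by
        gcongr
        exact_mod_cast five_pow_le_exp T
    _ = 2 * Real.exp (2 * T + -((1 / (900 * (K : ℝ) ^ 2)) ^ 2 * s ^ 2 / 196608)) := by
        rw [Real.exp_add]; ring
    _ ≤ _ := by gcongr; linarith

/-- The noise is small in the directions of a fixed subspace of dimension at most `T`. -/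
theorem measureReal_exists_norm_orthogonalProjectionOnto_noiseMap_le
    (hE : IsSubgaussianNoise E K μ) (hK : 0 < K) (hK1 : 1 ≤ 12 * (K : ℝ) ^ 2)
    (W : Submodule ℝ (EuclideanSpace ℝ (Fin m))) (hW : Module.finrank ℝ W ≤ T)
    {τ : ℝ} (hτ : 0 ≤ τ) :
    μ.real {ω | ∃ v, ‖v‖ = 1 ∧
        224 * (K : ℝ) ^ 2 * √T + τ < ‖W.orthogonalProjectionOnto (noiseMap E ω v)‖} ≤
      Real.exp (-(τ ^ 2 / (768 * K ^ 2))) := by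
  have hK' : (0 : ℝ) < K := hK
  have hK4 : (K : ℝ) ≤ 4 * K ^ 2 := by nlinarith
  -- The `4` undoes the loss from the nets. The `14` gives `14²/48 > 4`, beating the `25^T ≤ e^{4T}`
  -- pairs, and `4 · 14 K ≤ 224 K²`.
  set u := 14 * (K : ℝ) * √T + τ / 4 with hu
  have hu0 : 0 ≤ u := by positivity
  have hu4 : 4 * u ≤ 224 * (K : ℝ) ^ 2 * √T + τ := by
    have := mul_le_mul_of_nonneg_right hK4 (Real.sqrt_nonneg T)
    rw [hu]; linarith
  obtain ⟨N, hNc, hN1, hN⟩ := exists_half_net_sphere (EuclideanSpace ℝ (Fin T))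
  obtain ⟨N', hNc', hN1', hN'⟩ := exists_half_net_sphere W
  rw [finrank_euclideanSpace_fin] at hNc
  have hcard : (N ×ˢ N').card ≤ 5 ^ T * 5 ^ T := by
    rw [Finset.card_product]
    exact Nat.mul_le_mul hNc (hNc'.trans (Nat.pow_le_pow_right (by norm_num) hW))
  have hsub : {ω | ∃ v, ‖v‖ = 1 ∧
        224 * (K : ℝ) ^ 2 * √T + τ < ‖W.orthogonalProjectionOnto (noiseMap E ω v)‖} ⊆
      ⋃ p ∈ N ×ˢ N', {ω | u ≤ inner ℝ (p.2 : EuclideanSpace ℝ (Fin m)) (noiseMap E ω p.1)} := by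
    rintro ω ⟨v, hv, hlt⟩
    by_contra hω
    simp only [Set.mem_iUnion, not_exists, Set.mem_ofPred_eq, not_le] at hω
    exact (hu4.trans_lt hlt).not_ge (norm_orthogonalProjectionOnto_le_of_half_net
      (noiseMap E ω) W hN hN' hu0
      (fun c hc d hd => (hω (c, d) (Finset.mk_mem_product hc hd)).le) hv)
  refine (measureReal_mono hsub (measure_ne_top _ _)).trans ((measureReal_biUnion_finset_le_of_card_le hcard
    (by positivity) fun p hp => hE.measureReal_inner_noiseMap_ge_le hK
      (hN1 _ (Finset.mem_product.1 hp).1)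
      (by simpa using hN1' _ (Finset.mem_product.1 hp).2) hu0).trans ?_)
  have h1 : (14 * (K : ℝ) * √T) ^ 2 + (τ / 4) ^ 2 ≤ u ^ 2 := by
    have : 0 ≤ 14 * (K : ℝ) * √T * (τ / 4) := by positivity
    rw [hu, add_sq]; linarith
  rw [mul_pow, Real.sq_sqrt (Nat.cast_nonneg T)] at h1
  have h2 : ((14 * (K : ℝ)) ^ 2 * T + (τ / 4) ^ 2) / (48 * K ^ 2) ≤ u ^ 2 / (48 * K ^ 2) := by
    gcongr
  have h3 : ((14 * (K : ℝ)) ^ 2 * T + (τ / 4) ^ 2) / (48 * K ^ 2) =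
      196 / 48 * T + τ ^ 2 / (768 * K ^ 2) := by
    field_simp
    ring
  have h4 : (2 : ℝ) * T + 2 * T ≤ 196 / 48 * T := by
    have : (0 : ℝ) ≤ T := by positivity
    linarith
  have h5 := five_pow_le_exp T
  calc ((5 ^ T * 5 ^ T : ℕ) : ℝ) * Real.exp (-(u ^ 2 / (48 * (K : ℝ) ^ 2)))
      ≤ Real.exp (2 * T) * Real.exp (2 * T) * Real.exp (-(u ^ 2 / (48 * (K : ℝ) ^ 2))) := by
        push_cast
        gcongr
    _ = Real.exp (2 * T + 2 * T + -(u ^ 2 / (48 * (K : ℝ) ^ 2))) := by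
        rw [← Real.exp_add, ← Real.exp_add]
    _ ≤ _ := by gcongr; linarith

end IsSubgaussianNoise

end Concentration

/-! ### The gap between the singular values -/

section Submatrix

theorem Matrix.rank_eq_finrank_range_toEuclideanLin {m T : ℕ} (M : Matrix (Fin m) (Fin T) ℝ) :
    M.rank = Module.finrank ℝ (Matrix.toEuclideanLin M).range := by
  rw [Matrix.toEuclideanLin_eq_toLin_orthonormal]
  exact M.rank_eq_finrank_range_toLin _ _

theorem toEuclideanLin_observed_apply {Ω : Type*} {n T : ℕ} (M : Matrix (Fin n) (Fin T) ℝ)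
    (E : Fin n → Fin T → Ω → ℝ) (ω : Ω) (v : EuclideanSpace ℝ (Fin T)) :
    Matrix.toEuclideanLin (observed M E ω) v = Matrix.toEuclideanLin M v + noiseMap E ω v := by
  simp [observed, noiseMap]

theorem selectRows_observed {Ω : Type*} {n nA T : ℕ} (M : Matrix (Fin n) (Fin T) ℝ)
    (E : Fin n → Fin T → Ω → ℝ) (e : Fin nA ↪ Fin n) (ω : Ω) :
    selectRows (observed M E ω) e = observed (selectRows M e) (fun i => E (e i)) ω := by
  ext i j
  simp [selectRows, observed]

theorem singVal_fin_zero {T : ℕ} (A : Matrix (Fin 0) (Fin T) ℝ) (k : ℕ) : singVal A k = 0 := by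
  have : Matrix.toEuclideanLin A = 0 := by ext v i; exact i.elim0
  simp [singVal, this]

/-- Merges three failure probabilities with total weight `2 + 1 + 2 = 5` into the prefactor `2`.
With `y = e^{-x}`, either `1 - 2y ≤ 0`, or `y < 1/2` and `5y³ ≤ 2y`. -/
theorem one_sub_two_mul_exp_le {x : ℝ} : 1 - 2 * Real.exp (-x) ≤
    max 0 (1 - 5 * Real.exp (-(3 * x))) := by
  have e : Real.exp (-(3 * x)) = Real.exp (-x) ^ 3 := by
    rw [← Real.exp_nat_mul]; congr 1; push_cast; ring
  rw [e]
  have hy := Real.exp_pos (-x)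
  set y := Real.exp (-x)
  rcases le_or_gt (1 / 2) y with h | h
  · exact le_max_of_le_left (by linarith)
  · refine le_max_of_le_right ?_
    have : y ^ 3 ≤ y * (1 / 4) := by
      nlinarith [mul_pos (mul_pos hy (sub_pos.2 h)) (by linarith : 0 < 1 / 2 + y)]
    linarith

theorem one_sub_le_measureReal_singVal_sub {Ω : Type*} [MeasurableSpace Ω] {μ : Measure Ω}
    [IsProbabilityMeasure μ] {n T nA : ℕ} (M : Matrix (Fin n) (Fin T) ℝ)
    {E : Fin n → Fin T → Ω → ℝ} {K : ℝ≥0} (e : Fin nA ↪ Fin n) (hE : IsSubgaussianNoise E K μ)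
    (hn : 0 < n) (hM : M.rank < T) {t : ℝ} (ht : 0 ≤ t) :
    1 - 2 * Real.exp (-(min ((1 / (900 * (K : ℝ) ^ 2)) ^ 2 / 196608) (1 / (768 * (K : ℝ) ^ 2))
        / 12) * t ^ 2) ≤
      μ.real {ω | √(n : ℝ) - √(nA : ℝ) - 2000224 * (K : ℝ) ^ 2 * √(T : ℝ) - 2 * t ≤
        singVal (observed M E ω) (M.rank + 1) -
          singVal (selectRows (observed M E ω) e) ((selectRows M e).rank + 1)} := by
  have hK : 0 < K := hE.pos ⟨0, hn⟩ ⟨0, by omega⟩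
  have hK1 := hE.one_le_mul_sq hK ⟨0, hn⟩ ⟨0, by omega⟩
  set c₀ := min ((1 / (900 * (K : ℝ) ^ 2)) ^ 2 / 196608) (1 / (768 * (K : ℝ) ^ 2)) with hc₀
  set W := (Matrix.toEuclideanLin M).range
  have hW : Module.finrank ℝ W ≤ T := by
    rw [← M.rank_eq_finrank_range_toEuclideanLin]; exact hM.le
  -- Three deviations of `t/2` stay within `2t`. Squaring costs a factor `4` and merging the
  -- exponentials a factor `3`, whence the `12` in the exponent.
  have ht2 : 0 ≤ t / 2 := by linarith
  have p1 := hE.measureReal_exists_norm_noiseMap_le hK ht2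
  have p2 := hE.measureReal_exists_norm_orthogonalProjectionOnto_noiseMap_le hK hK1 W hW ht2
  have p3 := (hE.comp_embedding e).measureReal_exists_norm_noiseMap_le hK ht2
  set B₁ := {ω | ∃ v, ‖v‖ = 1 ∧ 10 ^ 6 * (K : ℝ) ^ 2 * √T + t / 2 < |‖noiseMap E ω v‖ - √n|}
  set B₂ := {ω | ∃ v, ‖v‖ = 1 ∧
    224 * (K : ℝ) ^ 2 * √T + t / 2 < ‖W.orthogonalProjectionOnto (noiseMap E ω v)‖}
  set B₃ := {ω | ∃ v, ‖v‖ = 1 ∧ 10 ^ 6 * (K : ℝ) ^ 2 * √T + t / 2 <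
    |‖noiseMap (fun i => E (e i)) ω v‖ - √nA|}
  set G := {ω | √(n : ℝ) - √(nA : ℝ) - 2000224 * (K : ℝ) ^ 2 * √(T : ℝ) - 2 * t ≤
        singVal (observed M E ω) (M.rank + 1) -
          singVal (selectRows (observed M E ω) e) ((selectRows M e).rank + 1)}
  have hcover : Set.univ ⊆ G ∪ (B₁ ∪ B₂ ∪ B₃) := by
    intro ω _
    by_cases hB : ω ∈ B₁ ∪ B₂ ∪ B₃
    · exact Or.inr hB
    refine Or.inl ?_
    simp only [Set.mem_union, not_or, B₁, B₂, B₃, Set.mem_ofPred_eq, not_exists, not_and,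
      not_lt] at hB
    obtain ⟨⟨h1, h2⟩, h3⟩ := hB
    have hX : √n - (10 ^ 6 * (K : ℝ) ^ 2 * √T + t / 2) - (224 * (K : ℝ) ^ 2 * √T + t / 2) ≤
        singVal (observed M E ω) (M.rank + 1) := by
      -- The zero-based index of `σ_{r+1}` is `r`, so `r < T` is exactly the range condition.
      refine LinearMap.le_singularValues_of_forall_le_norm _ (fun v hv => ?_) (by simpa using hM)
      rw [toEuclideanLin_observed_apply]
      have h4 := W.norm_sub_norm_orthogonalProjectionOnto_le
        (LinearMap.mem_range_self (Matrix.toEuclideanLin M) v) (noiseMap E ω v)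
      have h5 := (abs_le.1 (h1 v hv)).1
      have h6 := h2 v hv
      linarith
    have hA : singVal (selectRows (observed M E ω) e) ((selectRows M e).rank + 1) ≤
        √nA + (10 ^ 6 * (K : ℝ) ^ 2 * √T + t / 2) := by
      rw [singVal, Nat.add_sub_cancel, selectRows_observed,
        Matrix.rank_eq_finrank_range_toEuclideanLin]
      refine LinearMap.singularValues_finrank_range_le _ _ (by positivity) fun v hv => ?_
      rw [toEuclideanLin_observed_apply, add_sub_cancel_left]
      have h5 := (abs_le.1 (h3 v hv)).2
      linarith
    simp only [G, Set.mem_ofPred_eq]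
    linarith
  have hG : 1 ≤ μ.real G + (μ.real B₁ + μ.real B₂ + μ.real B₃) := by
    rw [← probReal_univ (μ := μ)]
    refine (measureReal_mono hcover).trans ((measureReal_union_le _ _).trans ?_)
    gcongr
    refine (measureReal_union_le _ _).trans ?_
    gcongr
    exact measureReal_union_le _ _
  have q1 : Real.exp (-((1 / (900 * (K : ℝ) ^ 2)) ^ 2 * (t / 2) ^ 2 / 196608)) ≤
      Real.exp (-(3 * (c₀ / 12 * t ^ 2))) := by
    have := mul_le_mul_of_nonneg_right (min_le_left ((1 / (900 * (K : ℝ) ^ 2)) ^ 2 / 196608)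
      (1 / (768 * (K : ℝ) ^ 2))) (sq_nonneg t)
    refine Real.exp_le_exp.2 ?_
    rw [← hc₀] at this
    linarith
  have q2 : Real.exp (-((t / 2) ^ 2 / (768 * (K : ℝ) ^ 2))) ≤
      Real.exp (-(3 * (c₀ / 12 * t ^ 2))) := by
    have := mul_le_mul_of_nonneg_right (min_le_right ((1 / (900 * (K : ℝ) ^ 2)) ^ 2 / 196608)
      (1 / (768 * (K : ℝ) ^ 2))) (sq_nonneg t)
    refine Real.exp_le_exp.2 ?_
    rw [← hc₀] at this
    have e : (t / 2) ^ 2 / (768 * (K : ℝ) ^ 2) = 1 / (768 * (K : ℝ) ^ 2) * t ^ 2 / 4 := by ring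
    rw [e]
    linarith
  rw [neg_mul]
  refine one_sub_two_mul_exp_le.trans (max_le measureReal_nonneg ?_)
  linarith

end Submatrix

theorem corollary4p15 :
    ∃ C : ℝ, 0 < C ∧ ∀ K : ℝ≥0, ∃ c : ℝ, 0 < c ∧
      ∀ {Ω : Type*} [MeasurableSpace Ω] (μ : Measure Ω) [IsProbabilityMeasure μ]
        (n T nA : ℕ)
        -- the signal, the noise, and the selected rows
        (M : Matrix (Fin n) (Fin T) ℝ) (E : Fin n → Fin T → Ω → ℝ) (e : Fin nA ↪ Fin n)
        -- independent, centred noise entries of unit variance and sub-Gaussian norm `K`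
        (_hmeas : ∀ i j, Measurable (E i j))
        (_hindep : iIndepFun (fun p : Fin n × Fin T => E p.1 p.2) μ)
        (_hmean : ∀ i j, ∫ ω, E i j ω ∂μ = 0)
        (_hvar : ∀ i j, variance (E i j) μ = 1)
        (_hnorm : ∀ i j, subgaussianNorm (E i j) μ = (K : ℝ≥0∞))
        -- the ranks of `M` and of the selected rows of `M`
        (r rS : ℕ) (_hr : M.rank = r) (_hrS : (selectRows M e).rank = rS)
        (t : ℝ) (_ht : 0 ≤ t) (_hrT : r < T)
        (_hnA : (nA : ℝ) < (√(n : ℝ) - C * (K : ℝ) ^ 2 * √(T : ℝ) - 2 * t) ^ 2),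
        1 - 2 * Real.exp (-c * t ^ 2) ≤
          μ.real {ω | √(n : ℝ) - √(nA : ℝ) - C * (K : ℝ) ^ 2 * √(T : ℝ) - 2 * t ≤
            singVal (observed M E ω) (r + 1) -
              singVal (selectRows (observed M E ω) e) (rS + 1)} := by
  refine ⟨2000224, by norm_num, fun K => ?_⟩
  -- For `K = 0` the formula would give zero; any positive `c` serves, since such noise has no
  -- entries when `T > 0`.
  obtain ⟨c, hc, hcK⟩ : ∃ c : ℝ, 0 < c ∧ (0 < K → c =
      min ((1 / (900 * (K : ℝ) ^ 2)) ^ 2 / 196608) (1 / (768 * (K : ℝ) ^ 2)) / 12) := by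
    rcases eq_or_ne K 0 with rfl | hK
    · exact ⟨1, one_pos, fun h => absurd h (lt_irrefl _)⟩
    · have : (0 : ℝ) < K := by positivity
      exact ⟨_, by positivity, fun _ => rfl⟩
  refine ⟨c, hc, ?_⟩
  intro Ω _ μ _ n T nA M E e hmeas hindep hmean hvar hnorm r rS hr hrS t ht hrT _
  subst hr hrS
  -- With no rows there is no entry to force `K > 0`, but both singular values vanish and the bound
  -- is at most zero.
  rcases Nat.eq_zero_or_pos n with rfl | hn
  · obtain rfl : nA = 0 := by simpa using Fintype.card_le_of_embedding e
    have hu : ∀ ω : Ω, √((0 : ℕ) : ℝ) - √((0 : ℕ) : ℝ) - 2000224 * (K : ℝ) ^ 2 * √(T : ℝ) - 2 * t ≤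
        singVal (observed M E ω) (M.rank + 1) -
          singVal (selectRows (observed M E ω) e) ((selectRows M e).rank + 1) := by
      intro ω
      rw [singVal_fin_zero, singVal_fin_zero]
      have : 0 ≤ 2000224 * (K : ℝ) ^ 2 * √(T : ℝ) := by positivity
      linarith
    simp only [hu, Set.ofPred_true, probReal_univ]
    linarith [Real.exp_pos (-c * t ^ 2)]
  · have hE : IsSubgaussianNoise E K μ := ⟨hmeas, hindep, hmean, hvar, fun i j => (hnorm i j).le⟩
    rw [hcK (hE.pos ⟨0, hn⟩ ⟨0, by omega⟩)]
    exact one_sub_le_measureReal_singVal_sub M e hE hn hrT ht
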